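/- Let $\Omega\subset\mathbb R^d$ be a bounded open set, $\omega\subset\Omega$ open, $T>0$, $Q=\Omega\times(0,T)$, $Q_\omega=\omega\times(0,T)$. Let $a,b\in L^\infty(Q)$ with $a\ge a_0>0$ a.e. in $Q$ for some constant $a_0$, and let $y_0\in L^2(\Omega)$. For $v\in L^2(Q_\omega)$ and $\eta\in L^2(\Omega)$, the weak solution of $$\partial_t y-\operatorname{div}(a\nabla y)+by=v\mathbf 1_\omega\ \text{in }Q,\qquad y=0\ \text{on }\partial\Omega\times(0,T),\qquad y(\cdot,0)=\eta\ \text{in }\Omega$$ is the function $y\in L^2(0,T;H^1_0(\Omega))$ with $$\iint_Q(-y\,\partial_t\varphi+a\nabla y\cdot\nabla\varphi+by\varphi)\,dx\,dt=\iint_{Q_\omega}v\varphi\,dx\,dt+\int_\Omega\eta\,\varphi(\cdot,0)\,dx\qquad\forall\varphi\in C_c^\infty(\Omega\times(-\infty,T)).$$ Let $M:L^2(Q_\omega)\to L^2(Q)$ be the bounded linear operator that maps $v$ to the weak solution with right-hand side $v\mathbf 1_\omega$ and $\eta=0$, let $M^*:L^2(Q)\to L^2(Q_\omega)$ be its adjoint,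 and let $\overline y$ be the weak solution with $v=0$ and $\eta=y_0$. Let $\rho,\rho_0$ be continuous functions on $Q$ that are bounded from below by a positive constant (for instance Carleman weights, which blow up as $t\to T^-$), let $\mathcal U=\{v\in L^2(Q_\omega):\rho_0v\in L^2(Q_\omega)\}$, and for $R>0$ set $\rho_R=\min(R,\rho)$. For $R,K>0$ and $(y,v,q)\in L^2(Q)\times\mathcal U\times L^2(Q)$ define $$\mathcal L_R(y,v,q)=\frac12\iint_Q\rho_R^2|y|^2\,dx\,dt+\frac12\iint_{Q_\omega}\rho_0^2|v|^2\,dx\,dt-(q,Mv+\overline y-y)_{L^2(Q)},$$ $$\mathcal L_{R,K}(y,v,q)=\mathcal L_R(y,v,q)+\frac K2\|Mv+\overline y-y\|_{L^2(Q)}^2.$$ A saddle point of $F:L^2(Q)\times\mathcal U\times L^2(Q)\to\mathbb R$ is a triple $(y,v,q)$ such that $F(y,v,p)\le F(y,v,q)\le F(z,w,q)$ for all $p\in L^2(Q)$ and $(z,w)\in L^2(Q)\times\mathcal U$. Theorem. Let $R>0$ and $K>0$. (a) A triple is a saddle point of $\mathcal L_R$ if and only if it is a saddle point of $\mathcal L_{R,K}$.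 Moreover, $\mathcal L_{R,K}$ has a unique saddle point $(y_R,v_R,q_R)$, and it satisfies $y_R=-\rho_R^{-2}q_R$ a.e. in $Q$ and $v_R=\rho_0^{-2}M^*q_R$ a.e. in $Q_\omega$. (b) $\mathcal L_{R,K}(y_R,v_R,q_R)=\mathcal L_R(y_R,v_R,q_R)$. -/

import Mathlib

open MeasureTheory Set Filter Topology
open scoped ENNReal InnerProductSpace

noncomputable section

namespace NullControl

/-- The space `ℝᵈ` with its Euclidean norm. -/
abbrev Space (d : ℕ) : Type := EuclideanSpace ℝ (Fin d)

/-- The data of the controlled parabolic problem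
`∂ₜ y - div (a ∇y) + b y = v 1_ω` in `Q = Ω × (0, T)`, `y = 0` on `∂Ω × (0, T)`, `y(·, 0) = y₀`.
Bounded measurable coefficients and an arbitrary bounded open set `Ω` are allowed; connected `Ω` of
class `C²` and `a ∈ W^{1,∞}(Q)` are a special case. -/
structure ParabolicProblem (d : ℕ) where
  /-- the bounded open set `Ω` -/
  Ω : Set (Space d)
  isOpen_Ω : IsOpen Ω
  isBounded_Ω : Bornology.IsBounded Ω
  /-- the control region `ω ⊆ Ω` -/
  ω : Set (Space d)
  isOpen_ω : IsOpen ω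
  ω_subset : ω ⊆ Ω
  /-- the final time -/
  T : ℝ
  T_pos : 0 < T
  /-- the diffusion coefficient `a(x, t)` -/
  a : Space d × ℝ → ℝ
  /-- the potential `b(x, t)` -/
  b : Space d × ℝ → ℝ
  a_memLp : MemLp a ∞ (volume.restrict (Ω ×ˢ Ioo 0 T))
  b_memLp : MemLp b ∞ (volume.restrict (Ω ×ˢ Ioo 0 T))
  a_elliptic : ∃ a₀ > 0, ∀ᵐ z ∂(volume.restrict (Ω ×ˢ Ioo 0 T)), a₀ ≤ a z
  /-- the initial state -/
  y₀ : Lp ℝ 2 (volume.restrict Ω)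

/-- The spatial gradient `∇ₓ φ` of a function of `(x, t)`. -/
def spatialGrad {d : ℕ} (φ : Space d × ℝ → ℝ) (z : Space d × ℝ) : Space d :=
  gradient (fun x => φ (x, z.2)) z.1

/-- The time derivative `∂ₜ φ` of a function of `(x, t)`. -/
def timeDeriv {d : ℕ} (φ : Space d × ℝ → ℝ) (z : Space d × ℝ) : ℝ :=
  deriv (fun t => φ (z.1, t)) z.2

/-- `u ∈ H₀¹(Ω)` with weak gradient `g`: there are `φₙ ∈ C_c^∞(Ω)` such that `φₙ → u` and
`∇φₙ → g` in `L²(Ω)`. -/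
def HasH10Gradient {d : ℕ} (Ω : Set (Space d)) (u : Space d → ℝ) (g : Space d → Space d) : Prop :=
  MemLp u 2 (volume.restrict Ω) ∧ MemLp g 2 (volume.restrict Ω) ∧
  ∃ φ : ℕ → Space d → ℝ,
    (∀ n, ContDiff ℝ (⊤ : ℕ∞) (φ n) ∧ HasCompactSupport (φ n) ∧ tsupport (φ n) ⊆ Ω) ∧
    Tendsto (fun n => eLpNorm (φ n - u) 2 (volume.restrict Ω)) atTop (𝓝 0) ∧
    Tendsto (fun n => eLpNorm (gradient (φ n) - g) 2 (volume.restrict Ω)) atTop (𝓝 0)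

/- ### Auxiliary facts for the construction of the solution operator -/

section lions

variable {V H D : Type*} [AddCommGroup V] [Module ℝ V]
  [NormedAddCommGroup H] [InnerProductSpace ℝ H] [CompleteSpace H]
  [NormedAddCommGroup D] [InnerProductSpace ℝ D] [CompleteSpace D]

/-- `A ψ ↦ B ψ` extends to a bounded operator if `‖B ψ‖ ≤ C ‖A ψ‖`. -/
theorem exists_extension (A : V →ₗ[ℝ] H) (B : V →ₗ[ℝ] D) (C : ℝ) (h : ∀ ψ, ‖B ψ‖ ≤ C * ‖A ψ‖) :
    ∃ F : H →L[ℝ] D, ∀ ψ, F (A ψ) = B ψ := by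
  let K : Submodule ℝ H := (LinearMap.range A).topologicalClosure
  have hK : ∀ ψ, A ψ ∈ K := fun ψ =>
    Submodule.le_topologicalClosure _ (LinearMap.mem_range_self A ψ)
  have : CompleteSpace K := (Submodule.isClosed_topologicalClosure _).completeSpace_coe
  let A' : V →ₗ[ℝ] K := A.codRestrict K hK
  have hd : DenseRange A' := by
    intro x
    rw [Metric.mem_closure_range_iff]
    intro ε hε
    have hx : (x : H) ∈ closure (LinearMap.range A : Set H) := x.2
    obtain ⟨y, ⟨ψ, rfl⟩, hy⟩ := Metric.mem_closure_iff.1 hx ε hε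
    exact ⟨ψ, hy⟩
  refine ⟨(B.extendOfNorm A').comp K.orthogonalProjectionOnto, fun ψ => ?_⟩
  have h1 : K.orthogonalProjectionOnto (A ψ) = A' ψ :=
    Submodule.orthogonalProjectionOnto_mem_subspace_eq_self (A' ψ)
  rw [ContinuousLinearMap.comp_apply, h1]
  exact LinearMap.extendOfNorm_eq hd ⟨C, h⟩ ψ

/-- A form of the theorem of Lions on variational problems. -/
theorem exists_variational_solution (J A : V →ₗ[ℝ] H) (B : V →ₗ[ℝ] D) (m : V → V) (κ C : ℝ)
    (hκ : 0 < κ) (hC : 0 ≤ C)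
    (h1 : ∀ ψ, κ * ‖J (m ψ)‖ ^ 2 ≤ ⟪J (m ψ), A ψ⟫_ℝ)
    (h2 : ∀ ψ, ‖B ψ‖ ^ 2 ≤ C * ⟪J (m ψ), A ψ⟫_ℝ) :
    ∃ F : D →L[ℝ] H, (∀ e, F e ∈ closure (range J)) ∧ ∀ e ψ, ⟪F e, A ψ⟫_ℝ = ⟪e, B ψ⟫_ℝ := by
  let K : Submodule ℝ H := (LinearMap.range J).topologicalClosure
  have : CompleteSpace K := (Submodule.isClosed_topologicalClosure _).completeSpace_coe
  have hK : ∀ ψ, J ψ ∈ K := fun ψ =>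
    Submodule.le_topologicalClosure _ (LinearMap.mem_range_self J ψ)
  let P := K.starProjection
  have hP : ∀ ψ x, ⟪J ψ, P x⟫_ℝ = ⟪J ψ, x⟫_ℝ := by
    intro ψ x
    rw [← Submodule.inner_starProjection_left_eq_right,
      Submodule.starProjection_eq_self_iff.2 (hK ψ)]
  have key : ∀ ψ, ‖B ψ‖ ≤ Real.sqrt (C / κ) * ‖(P.toLinearMap ∘ₗ A) ψ‖ := by
    intro ψ
    have e1 := h1 ψ
    have e2 := h2 ψ
    rw [← hP] at e1 e2
    have e3 := real_inner_le_norm (J (m ψ)) (P (A ψ))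
    change _ ≤ _ * ‖P (A ψ)‖
    set j := ‖J (m ψ)‖
    set p := ‖P (A ψ)‖
    have hj : 0 ≤ j := norm_nonneg _
    have hp : 0 ≤ p := norm_nonneg _
    have e4 : κ * j ≤ p := by
      rcases hj.eq_or_lt with h | h
      · rw [← h]; simpa using hp
      · nlinarith
    have e5 : ‖B ψ‖ ^ 2 ≤ C / κ * p ^ 2 := by
      calc ‖B ψ‖ ^ 2 ≤ C * (j * p) := e2.trans (by gcongr)
        _ = C / κ * ((κ * j) * p) := by field_simp
        _ ≤ C / κ * (p * p) := by gcongr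
        _ = _ := by ring
    have := Real.sqrt_le_sqrt e5
    rwa [Real.sqrt_sq (norm_nonneg _), Real.sqrt_mul (by positivity), Real.sqrt_sq hp] at this
  obtain ⟨F, hF⟩ := exists_extension (P.toLinearMap ∘ₗ A) B _ key
  refine ⟨P.comp (ContinuousLinearMap.adjoint F), fun e => ?_, fun e ψ => ?_⟩
  · have : P (ContinuousLinearMap.adjoint F e) ∈ K := Submodule.starProjection_apply_mem K _
    exact this
  · rw [ContinuousLinearMap.comp_apply, Submodule.inner_starProjection_left_eq_right,
      ContinuousLinearMap.adjoint_inner_left]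
    congr 1
    exact hF ψ

end lions

section calculus

variable {d : ℕ} {φ ψ : Space d × ℝ → ℝ}

theorem hasDerivAt_time (h : Differentiable ℝ φ) (z : Space d × ℝ) :
    HasDerivAt (fun t => φ (z.1, t)) (fderiv ℝ φ z (0, 1)) z.2 := by
  have h1 : HasDerivAt (fun t : ℝ => (z.1, t)) ((0 : Space d), (1 : ℝ)) z.2 :=
    (hasDerivAt_const _ _).prodMk (hasDerivAt_id _)
  exact (h z).hasFDerivAt.comp_hasDerivAt z.2 h1

theorem timeDeriv_eq (h : Differentiable ℝ φ) :
    timeDeriv φ = fun z => fderiv ℝ φ z (0, 1) := by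
  funext z
  exact (hasDerivAt_time h z).deriv

theorem spatialGrad_eq (h : Differentiable ℝ φ) :
    spatialGrad φ = fun z => (InnerProductSpace.toDual ℝ (Space d)).symm
      ((fderiv ℝ φ z).comp (ContinuousLinearMap.inl ℝ (Space d) ℝ)) := by
  funext z
  have h1 : HasFDerivAt (fun x : Space d => (x, z.2)) (ContinuousLinearMap.inl ℝ (Space d) ℝ) z.1 :=
    (hasFDerivAt_id z.1).prodMk (hasFDerivAt_const z.2 z.1)
  have h2 : HasFDerivAt (fun x => φ (x, z.2))
      ((fderiv ℝ φ z).comp (ContinuousLinearMap.inl ℝ (Space d) ℝ)) z.1 :=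
    (h z).hasFDerivAt.comp (f := fun x : Space d => (x, z.2)) z.1 h1
  unfold spatialGrad gradient
  rw [h2.fderiv]

theorem continuous_timeDeriv (h : ContDiff ℝ (⊤ : ℕ∞) φ) : Continuous (timeDeriv φ) := by
  rw [timeDeriv_eq (h.differentiable (by simp))]
  exact (h.continuous_fderiv (by simp)).clm_apply continuous_const

theorem continuous_spatialGrad (h : ContDiff ℝ (⊤ : ℕ∞) φ) : Continuous (spatialGrad φ) := by
  rw [spatialGrad_eq (h.differentiable (by simp))]
  exact (LinearIsometryEquiv.continuous _).comp
    ((h.continuous_fderiv (by simp)).clm_comp continuous_const)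

theorem hasCompactSupport_timeDeriv (h : ContDiff ℝ (⊤ : ℕ∞) φ) (hc : HasCompactSupport φ) :
    HasCompactSupport (timeDeriv φ) := by
  rw [timeDeriv_eq (h.differentiable (by simp))]
  exact (hc.fderiv ℝ).comp_left (g := fun L : (Space d × ℝ) →L[ℝ] ℝ => L (0, 1)) rfl

theorem hasCompactSupport_spatialGrad (h : ContDiff ℝ (⊤ : ℕ∞) φ) (hc : HasCompactSupport φ) :
    HasCompactSupport (spatialGrad φ) := by
  rw [spatialGrad_eq (h.differentiable (by simp))]
  exact (hc.fderiv ℝ).comp_left (g := fun L : (Space d × ℝ) →L[ℝ] ℝ =>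
    (InnerProductSpace.toDual ℝ (Space d)).symm
      (L.comp (ContinuousLinearMap.inl ℝ (Space d) ℝ))) (by simp)

theorem timeDeriv_add (h : ContDiff ℝ (⊤ : ℕ∞) φ) (h' : ContDiff ℝ (⊤ : ℕ∞) ψ) :
    timeDeriv (φ + ψ) = timeDeriv φ + timeDeriv ψ := by
  have a := h.differentiable (by simp)
  have b := h'.differentiable (by simp)
  rw [timeDeriv_eq a, timeDeriv_eq b, timeDeriv_eq (a.add b)]
  funext z
  simp [fderiv_add (a z) (b z)]

theorem spatialGrad_add (h : ContDiff ℝ (⊤ : ℕ∞) φ) (h' : ContDiff ℝ (⊤ : ℕ∞) ψ) :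
    spatialGrad (φ + ψ) = spatialGrad φ + spatialGrad ψ := by
  have a := h.differentiable (by simp)
  have b := h'.differentiable (by simp)
  rw [spatialGrad_eq a, spatialGrad_eq b, spatialGrad_eq (a.add b)]
  funext z
  simp [fderiv_add (a z) (b z), ContinuousLinearMap.add_comp]

theorem timeDeriv_smul (c : ℝ) (h : ContDiff ℝ (⊤ : ℕ∞) φ) :
    timeDeriv (c • φ) = c • timeDeriv φ := by
  have a := h.differentiable (by simp)
  rw [timeDeriv_eq a, timeDeriv_eq (a.const_smul c)]
  funext z
  simp [fderiv_const_smul (a z) c]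

theorem spatialGrad_smul (c : ℝ) (h : ContDiff ℝ (⊤ : ℕ∞) φ) :
    spatialGrad (c • φ) = c • spatialGrad φ := by
  have a := h.differentiable (by simp)
  rw [spatialGrad_eq a, spatialGrad_eq (a.const_smul c)]
  funext z
  simp [fderiv_const_smul (a z) c]

end calculus

namespace ParabolicProblem

variable {d : ℕ} (S : ParabolicProblem d)

/-- The space-time cylinder `Q = Ω × (0, T)`. -/
def Q : Set (Space d × ℝ) := S.Ω ×ˢ Ioo 0 S.T

/-- The control cylinder `Q_ω = ω × (0, T)`. -/
def Qω : Set (Space d × ℝ) := S.ω ×ˢ Ioo 0 S.T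

/-- `L²(Q)`. -/
abbrev L2Q : Type := Lp ℝ 2 (volume.restrict S.Q)

/-- `L²(Q_ω)`. -/
abbrev L2Qω : Type := Lp ℝ 2 (volume.restrict S.Qω)

/-- `L²(Ω)`. -/
abbrev L2Ω : Type := Lp ℝ 2 (volume.restrict S.Ω)

/-- The test functions: smooth functions on `ℝᵈ × ℝ` with compact support in `Ω × (-∞, T)`.
They vanish near `∂Ω` and near `t = T`, but are arbitrary at `t = 0`. -/
def testFunctions : Submodule ℝ (Space d × ℝ → ℝ) where
  carrier := {φ | ContDiff ℝ (⊤ : ℕ∞) φ ∧ HasCompactSupport φ ∧ tsupport φ ⊆ S.Ω ×ˢ Iio S.T}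
  zero_mem' := ⟨contDiff_const, HasCompactSupport.zero, by simp [tsupport]⟩
  add_mem' := fun {f g} hf hg => ⟨hf.1.add hg.1, hf.2.1.add hg.2.1,
    (tsupport_add f g).trans (union_subset hf.2.2 hg.2.2)⟩
  smul_mem' := fun c f hf => ⟨contDiff_const.smul hf.1,
    hf.2.1.smul_left (f := fun _ => c), (tsupport_smul_subset_right (fun _ => c) f).trans hf.2.2⟩

/-- `y` is the weak solution of `∂ₜ y - div (a ∇y) + b y = v 1_ω` in `Q`, `y = 0` on
`∂Ω × (0, T)`, `y(·, 0) = η`: one has `y ∈ L²(0, T; H₀¹(Ω))`, with spatial gradient `G`, and the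
equation and the initial condition hold in the weak sense:
`∬_Q (-y ∂ₜφ + a ∇y·∇φ + b y φ) = ∬_{Q_ω} v φ + ∫_Ω η φ(·, 0)` for every test function `φ`.
This determines `y` uniquely, and `y ∈ C⁰([0, T]; L²(Ω))` is a consequence. -/
def IsWeakSolution (v : S.L2Qω) (η : S.L2Ω) (y : S.L2Q) : Prop :=
  ∃ G : Lp (Space d) 2 (volume.restrict S.Q),
    (∀ᵐ t ∂(volume.restrict (Ioo 0 S.T)),
      HasH10Gradient S.Ω (fun x => y (x, t)) (fun x => G (x, t))) ∧
    ∀ φ ∈ S.testFunctions,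
      ∫ z in S.Q, (-(y z * timeDeriv φ z) + S.a z * ⟪G z, spatialGrad φ z⟫_ℝ
          + S.b z * y z * φ z) =
        (∫ z in S.Qω, v z * φ z) + ∫ x in S.Ω, η x * φ (x, 0)

/- ### Construction of weak solutions -/

theorem measurableSet_Q : MeasurableSet S.Q := S.isOpen_Ω.measurableSet.prod measurableSet_Ioo

theorem measurableSet_Qω : MeasurableSet S.Qω := S.isOpen_ω.measurableSet.prod measurableSet_Ioo

theorem Qω_subset : S.Qω ⊆ S.Q := prod_mono S.ω_subset Subset.rfl

theorem volume_Q : (volume.restrict S.Q : Measure (Space d × ℝ)) =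
    (volume.restrict S.Ω).prod (volume.restrict (Ioo 0 S.T)) :=
  (Measure.prod_restrict S.Ω (Ioo 0 S.T)).symm

/-- A linear family of square-integrable functions as a linear map into `L²`. -/
def lpMap {α V F : Type*} [MeasurableSpace α] [AddCommGroup V] [Module ℝ V]
    [NormedAddCommGroup F] [NormedSpace ℝ F] (μ : Measure α) (L : V →ₗ[ℝ] (α → F))
    (h : ∀ v, MemLp (L v) 2 μ) : V →ₗ[ℝ] Lp F 2 μ where
  toFun v := (h v).toLp (L v)
  map_add' u v := by
    rw [← MemLp.toLp_add]
    exact MemLp.toLp_congr _ _ (by rw [map_add])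
  map_smul' c v := by
    rw [RingHom.id_apply, ← MemLp.toLp_const_smul]
    exact MemLp.toLp_congr _ _ (by rw [map_smul])

theorem coeFn_lpMap {α V F : Type*} [MeasurableSpace α] [AddCommGroup V] [Module ℝ V]
    [NormedAddCommGroup F] [NormedSpace ℝ F] (μ : Measure α) (L : V →ₗ[ℝ] (α → F))
    (h : ∀ v, MemLp (L v) 2 μ) (v : V) : lpMap μ L h v =ᵐ[μ] L v :=
  (h v).coeFn_toLp

/-- `φ ↦ ∂ₜφ` -/
def timeL : S.testFunctions →ₗ[ℝ] (Space d × ℝ → ℝ) where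
  toFun φ := timeDeriv φ
  map_add' φ ψ := timeDeriv_add φ.2.1 ψ.2.1
  map_smul' c φ := timeDeriv_smul c φ.2.1

/-- `φ ↦ ∇ₓφ` -/
def gradL : S.testFunctions →ₗ[ℝ] (Space d × ℝ → Space d) where
  toFun φ := spatialGrad φ
  map_add' φ ψ := spatialGrad_add φ.2.1 ψ.2.1
  map_smul' c φ := spatialGrad_smul c φ.2.1

/-- `φ ↦ φ(·, 0)` -/
def traceL : S.testFunctions →ₗ[ℝ] (Space d → ℝ) where
  toFun φ := fun x => (φ : Space d × ℝ → ℝ) (x, 0)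
  map_add' _ _ := rfl
  map_smul' _ _ := rfl

/-- Multiplication of a linear family of functions by a fixed function `a`. -/
def mulL {α V F : Type*} [AddCommGroup V] [Module ℝ V] [AddCommGroup F] [Module ℝ F]
    (a : α → ℝ) (L : V →ₗ[ℝ] (α → F)) : V →ₗ[ℝ] (α → F) where
  toFun v := fun z => a z • L v z
  map_add' u v := by funext z; simp
  map_smul' c v := by
    funext z
    simp only [map_smul, Pi.smul_apply, RingHom.id_apply]
    exact smul_comm _ _ _

section memLp

variable (μ : Measure (Space d × ℝ)) [IsFiniteMeasureOnCompacts μ]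

theorem memLp_val (p : ℝ≥0∞) (φ : S.testFunctions) : MemLp (φ : Space d × ℝ → ℝ) p μ :=
  φ.2.1.continuous.memLp_of_hasCompactSupport φ.2.2.1

theorem memLp_time (p : ℝ≥0∞) (φ : S.testFunctions) : MemLp (timeDeriv (φ : Space d × ℝ → ℝ)) p μ :=
  (continuous_timeDeriv φ.2.1).memLp_of_hasCompactSupport
    (hasCompactSupport_timeDeriv φ.2.1 φ.2.2.1)

theorem memLp_grad (p : ℝ≥0∞) (φ : S.testFunctions) :
    MemLp (spatialGrad (φ : Space d × ℝ → ℝ)) p μ :=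
  (continuous_spatialGrad φ.2.1).memLp_of_hasCompactSupport
    (hasCompactSupport_spatialGrad φ.2.1 φ.2.2.1)

end memLp

theorem hasCompactSupport_slice (φ : S.testFunctions) (t : ℝ) :
    HasCompactSupport (fun x => (φ : Space d × ℝ → ℝ) (x, t)) := by
  refine HasCompactSupport.intro (K := Prod.fst '' tsupport (φ : Space d × ℝ → ℝ))
    (φ.2.2.1.isCompact.image continuous_fst) fun x hx => ?_
  by_contra h
  exact hx ⟨(x, t), subset_tsupport _ h, rfl⟩

theorem tsupport_slice (φ : S.testFunctions) (t : ℝ) :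
    tsupport (fun x => (φ : Space d × ℝ → ℝ) (x, t)) ⊆ S.Ω := by
  have h : tsupport (fun x => (φ : Space d × ℝ → ℝ) (x, t)) ⊆
      (fun x => (x, t)) ⁻¹' tsupport (φ : Space d × ℝ → ℝ) := by
    refine closure_minimal ?_ ((isClosed_tsupport _).preimage (by fun_prop))
    intro x hx
    exact subset_tsupport _ hx
  intro x hx
  exact (φ.2.2.2 (h hx)).1

theorem memLp_trace (p : ℝ≥0∞) (ν : Measure (Space d)) [IsFiniteMeasureOnCompacts ν]
    (φ : S.testFunctions) : MemLp (fun x => (φ : Space d × ℝ → ℝ) (x, 0)) p ν :=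
  (φ.2.1.continuous.comp (by fun_prop)).memLp_of_hasCompactSupport (S.hasCompactSupport_slice φ 0)

/-- `φ ↦ (φ, ∇φ)` -/
def embL : S.testFunctions →ₗ[ℝ] WithLp 2 (S.L2Q × Lp (Space d) 2 (volume.restrict S.Q)) :=
  (WithLp.linearEquiv 2 ℝ _).symm.toLinearMap ∘ₗ
    (lpMap _ S.testFunctions.subtype (S.memLp_val _ 2)).prod (lpMap _ S.gradL (S.memLp_grad _ 2))

/-- `φ ↦ (-∂ₜφ + b φ, a ∇φ)` -/
def adjL : S.testFunctions →ₗ[ℝ] WithLp 2 (S.L2Q × Lp (Space d) 2 (volume.restrict S.Q)) :=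
  (WithLp.linearEquiv 2 ℝ _).symm.toLinearMap ∘ₗ
    (lpMap _ (mulL S.b S.testFunctions.subtype - S.timeL)
      (fun φ => ((S.memLp_val _ 2 φ).smul S.b_memLp).sub (S.memLp_time _ 2 φ))).prod
    (lpMap _ (mulL S.a S.gradL) (fun φ => (S.memLp_grad _ 2 φ).smul S.a_memLp))

/-- `φ ↦ (φ|_{Q_ω}, φ(·, 0))` -/
def dataL : S.testFunctions →ₗ[ℝ] WithLp 2 (S.L2Qω × S.L2Ω) :=
  (WithLp.linearEquiv 2 ℝ _).symm.toLinearMap ∘ₗ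
    (lpMap _ S.testFunctions.subtype (S.memLp_val _ 2)).prod
    (lpMap _ S.traceL (S.memLp_trace 2 _))

theorem inner_adjL (Y : WithLp 2 (S.L2Q × Lp (Space d) 2 (volume.restrict S.Q)))
    (φ : S.testFunctions) :
    ⟪Y, S.adjL φ⟫_ℝ = ∫ z in S.Q, (-(Y.fst z * timeDeriv φ z)
      + S.a z * ⟪Y.snd z, spatialGrad φ z⟫_ℝ + S.b z * Y.fst z * φ.1 z) := by
  rw [WithLp.prod_inner_apply, L2.inner_def, L2.inner_def,
    ← integral_add (L2.integrable_inner _ _) (L2.integrable_inner _ _)]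
  refine integral_congr_ae ?_
  have e1 := coeFn_lpMap (volume.restrict S.Q) (mulL S.b S.testFunctions.subtype - S.timeL)
      (fun φ => ((S.memLp_val _ 2 φ).smul S.b_memLp).sub (S.memLp_time _ 2 φ)) φ
  have e2 := coeFn_lpMap (volume.restrict S.Q) (mulL S.a S.gradL)
      (fun φ => (S.memLp_grad _ 2 φ).smul S.a_memLp) φ
  filter_upwards [e1, e2] with z h1 h2
  change ⟪Y.fst z, lpMap (volume.restrict S.Q) (mulL S.b S.testFunctions.subtype - S.timeL) _ φ z⟫_ℝ
    + ⟪Y.snd z, lpMap (volume.restrict S.Q) (mulL S.a S.gradL) _ φ z⟫_ℝ = _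
  rw [h1, h2]
  change ⟪Y.fst z, S.b z * φ.1 z - timeDeriv φ z⟫_ℝ + ⟪Y.snd z, S.a z • spatialGrad φ z⟫_ℝ = _
  rw [inner_smul_right]
  simp only [RCLike.inner_apply, conj_trivial]
  ring

theorem inner_dataL (v : S.L2Qω) (η : S.L2Ω) (φ : S.testFunctions) :
    ⟪WithLp.toLp 2 (v, η), S.dataL φ⟫_ℝ =
      (∫ z in S.Qω, v z * φ.1 z) + ∫ x in S.Ω, η x * φ.1 (x, 0) := by
  rw [WithLp.prod_inner_apply, L2.inner_def, L2.inner_def]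
  congr 1
  · refine integral_congr_ae ?_
    filter_upwards [coeFn_lpMap (volume.restrict S.Qω) S.testFunctions.subtype
      (S.memLp_val _ 2) φ] with z h
    change ⟪v z, lpMap (volume.restrict S.Qω) S.testFunctions.subtype _ φ z⟫_ℝ = _
    rw [h]
    simp [mul_comm]
  · refine integral_congr_ae ?_
    filter_upwards [coeFn_lpMap (volume.restrict S.Ω) S.traceL
      (S.memLp_trace 2 _) φ] with z h
    change ⟪η z, lpMap (volume.restrict S.Ω) S.traceL _ φ z⟫_ℝ = _
    rw [h]
    simp [mul_comm, traceL]

theorem norm_dataL_sq (φ : S.testFunctions) :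
    ‖S.dataL φ‖ ^ 2 = (∫ z in S.Qω, φ.1 z ^ 2) + ∫ x in S.Ω, φ.1 (x, 0) ^ 2 := by
  rw [← real_inner_self_eq_norm_sq, WithLp.prod_inner_apply, L2.inner_def, L2.inner_def]
  congr 1
  · refine integral_congr_ae ?_
    filter_upwards [coeFn_lpMap (volume.restrict S.Qω) S.testFunctions.subtype
      (S.memLp_val _ 2) φ] with z h
    change ⟪lpMap (volume.restrict S.Qω) S.testFunctions.subtype _ φ z,
      lpMap (volume.restrict S.Qω) S.testFunctions.subtype _ φ z⟫_ℝ = _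
    rw [h]
    simp
  · refine integral_congr_ae ?_
    filter_upwards [coeFn_lpMap (volume.restrict S.Ω) S.traceL
      (S.memLp_trace 2 _) φ] with z h
    change ⟪lpMap (volume.restrict S.Ω) S.traceL _ φ z,
      lpMap (volume.restrict S.Ω) S.traceL _ φ z⟫_ℝ = _
    rw [h]
    simp [traceL]

theorem norm_embL_sq (φ : S.testFunctions) :
    ‖S.embL φ‖ ^ 2 = ∫ z in S.Q, (φ.1 z ^ 2 + ‖spatialGrad φ.1 z‖ ^ 2) := by
  rw [← real_inner_self_eq_norm_sq, WithLp.prod_inner_apply, L2.inner_def, L2.inner_def,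
    ← integral_add (L2.integrable_inner _ _) (L2.integrable_inner _ _)]
  refine integral_congr_ae ?_
  filter_upwards [coeFn_lpMap (volume.restrict S.Q) S.testFunctions.subtype
      (S.memLp_val _ 2) φ, coeFn_lpMap (volume.restrict S.Q) S.gradL
      (S.memLp_grad _ 2) φ] with z h1 h2
  change ⟪lpMap (volume.restrict S.Q) S.testFunctions.subtype _ φ z,
      lpMap (volume.restrict S.Q) S.testFunctions.subtype _ φ z⟫_ℝ +
    ⟪lpMap (volume.restrict S.Q) S.gradL _ φ z, lpMap (volume.restrict S.Q) S.gradL _ φ z⟫_ℝ = _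
  rw [h1, h2, real_inner_self_eq_norm_sq, real_inner_self_eq_norm_sq]
  simp [gradL]

theorem integral_time_identity (lam : ℝ) (ψ : S.testFunctions) :
    ∫ z in S.Q, Real.exp (2 * lam * z.2) * (2 * ψ.1 z * timeDeriv ψ.1 z + 2 * lam * ψ.1 z ^ 2) =
      - ∫ x in S.Ω, ψ.1 (x, 0) ^ 2 := by
  have hc : Continuous ψ.1 := ψ.2.1.continuous
  have ht := continuous_timeDeriv ψ.2.1
  have hcs : HasCompactSupport (fun z : Space d × ℝ => Real.exp (2 * lam * z.2) *
      (2 * ψ.1 z * timeDeriv ψ.1 z + 2 * lam * ψ.1 z ^ 2)) := by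
    refine ψ.2.2.1.mono' ?_
    intro z hz
    by_contra h
    exact hz (by simp [image_eq_zero_of_notMem_tsupport h])
  have hcont : Continuous (fun z : Space d × ℝ => Real.exp (2 * lam * z.2) *
      (2 * ψ.1 z * timeDeriv ψ.1 z + 2 * lam * ψ.1 z ^ 2)) := by fun_prop
  have hint := hcont.integrable_of_hasCompactSupport hcs (μ := volume)
  have e : ∫ z in S.Q, Real.exp (2 * lam * z.2) *
        (2 * ψ.1 z * timeDeriv ψ.1 z + 2 * lam * ψ.1 z ^ 2) =
      ∫ x in S.Ω, ∫ t in Ioo 0 S.T, Real.exp (2 * lam * t) *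
        (2 * ψ.1 (x, t) * timeDeriv ψ.1 (x, t) + 2 * lam * ψ.1 (x, t) ^ 2) :=
    setIntegral_prod _ hint.integrableOn
  rw [e, ← integral_neg]
  refine integral_congr_ae (Eventually.of_forall fun x => ?_)
  have hd : ∀ t, HasDerivAt (fun t => Real.exp (2 * lam * t) * ψ.1 (x, t) ^ 2)
      (Real.exp (2 * lam * t) *
        (2 * ψ.1 (x, t) * timeDeriv ψ.1 (x, t) + 2 * lam * ψ.1 (x, t) ^ 2)) t := by
    intro t
    have h1 : HasDerivAt (fun t => ψ.1 (x, t)) (timeDeriv ψ.1 (x, t)) t := by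
      have := hasDerivAt_time (ψ.2.1.differentiable (by simp)) (x, t)
      rwa [timeDeriv_eq (ψ.2.1.differentiable (by simp))]
    have h2 : HasDerivAt (fun t => Real.exp (2 * lam * t))
        (Real.exp (2 * lam * t) * (2 * lam * 1)) t :=
      ((hasDerivAt_id t).const_mul (2 * lam)).exp
    refine (h2.mul (h1.pow 2)).congr_deriv ?_
    simp only [Pi.pow_apply, Nat.cast_ofNat]
    ring
  have h0 : ψ.1 (x, S.T) = 0 :=
    image_eq_zero_of_notMem_tsupport fun h => lt_irrefl S.T (ψ.2.2.2 h).2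
  change ∫ t in Ioo 0 S.T, _ = _
  rw [← integral_Ioc_eq_integral_Ioo, ← intervalIntegral.integral_of_le S.T_pos.le,
    intervalIntegral.integral_eq_sub_of_hasDerivAt (fun t _ => hd t)
      ((hcont.comp (by fun_prop : Continuous fun t : ℝ => (x, t))).intervalIntegrable _ _)]
  simp [h0]

/-- Multiplication of test functions by `e^{2λt}`. -/
def expMul (lam : ℝ) (ψ : S.testFunctions) : S.testFunctions :=
  ⟨fun z => Real.exp (2 * lam * z.2) * ψ.1 z, by
    refine ⟨ContDiff.mul (by fun_prop) ψ.2.1, ψ.2.2.1.mul_left,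
      (tsupport_mul_subset_right).trans ψ.2.2.2⟩⟩

theorem spatialGrad_expMul (lam : ℝ) (ψ : S.testFunctions) (z : Space d × ℝ) :
    spatialGrad (S.expMul lam ψ).1 z = Real.exp (2 * lam * z.2) • spatialGrad ψ.1 z := by
  have h : DifferentiableAt ℝ (fun x => ψ.1 (x, z.2)) z.1 :=
    ((ψ.2.1.differentiable (by simp)).comp (by fun_prop)) z.1
  unfold spatialGrad gradient expMul
  simp only
  rw [fderiv_const_mul h, map_smul]

theorem coercivity : ∃ κ > 0, ∃ C ≥ 0, ∃ lam : ℝ, ∀ ψ : S.testFunctions,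
    κ * ‖S.embL (S.expMul lam ψ)‖ ^ 2 ≤ ⟪S.embL (S.expMul lam ψ), S.adjL ψ⟫_ℝ ∧
    ‖S.dataL ψ‖ ^ 2 ≤ C * ⟪S.embL (S.expMul lam ψ), S.adjL ψ⟫_ℝ := by
  obtain ⟨a₀, ha₀, ha⟩ := S.a_elliptic
  have hb : ∃ β ≥ 0, ∀ᵐ z ∂(volume.restrict S.Q), |S.b z| ≤ β := by
    refine ⟨(eLpNorm S.b ∞ (volume.restrict S.Q)).toReal, ENNReal.toReal_nonneg, ?_⟩
    have hlt : eLpNorm S.b ∞ (volume.restrict S.Q) ≠ ∞ := S.b_memLp.2.ne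
    have := ae_le_eLpNormEssSup (f := S.b) (μ := volume.restrict S.Q)
    filter_upwards [this] with z hz
    rw [← eLpNorm_exponent_top] at hz
    have := ENNReal.toReal_mono hlt hz
    simpa using this
  obtain ⟨β, hβ, hb⟩ := hb
  set lam := β + 1 with hlam
  set c := min 1 a₀ with hcdef
  have hc0 : 0 < c := lt_min one_pos ha₀
  set M := Real.exp (2 * lam * S.T) with hM
  have hM0 : 0 < M := Real.exp_pos _
  refine ⟨c / M, by positivity, 2 + 1 / c, by positivity, lam, fun ψ => ?_⟩
  have hc : Continuous ψ.1 := ψ.2.1.continuous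
  have ht := continuous_timeDeriv ψ.2.1
  have hg := continuous_spatialGrad ψ.2.1
  have hgc := hasCompactSupport_spatialGrad ψ.2.1 ψ.2.2.1
  let w : Space d × ℝ → ℝ := fun z => Real.exp (2 * lam * z.2)
  have hw : Continuous w := by fun_prop
  have hinner : ⟪S.embL (S.expMul lam ψ), S.adjL ψ⟫_ℝ =
      ∫ z in S.Q, w z * (-(ψ.1 z * timeDeriv ψ.1 z)
        + S.a z * ‖spatialGrad ψ.1 z‖ ^ 2 + S.b z * ψ.1 z ^ 2) := by
    rw [inner_adjL]
    refine integral_congr_ae ?_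
    filter_upwards [coeFn_lpMap (volume.restrict S.Q) S.testFunctions.subtype
      (S.memLp_val _ 2) (S.expMul lam ψ), coeFn_lpMap (volume.restrict S.Q) S.gradL
      (S.memLp_grad _ 2) (S.expMul lam ψ)] with z h1 h2
    have h1' : (S.embL (S.expMul lam ψ)).fst z = w z * ψ.1 z := h1
    have h2' : (S.embL (S.expMul lam ψ)).snd z = w z • spatialGrad ψ.1 z :=
      h2.trans (S.spatialGrad_expMul lam ψ z)
    rw [h1', h2', real_inner_smul_left, real_inner_self_eq_norm_sq]
    ring
  have i1 : IntegrableOn (fun z => w z * (ψ.1 z ^ 2 + ‖spatialGrad ψ.1 z‖ ^ 2)) S.Q := by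
    refine (Continuous.integrable_of_hasCompactSupport (by fun_prop) ?_).integrableOn
    refine HasCompactSupport.mul_left (HasCompactSupport.add ?_ ?_)
    · exact ψ.2.2.1.comp_left (g := fun x => x ^ 2) (by simp)
    · exact hgc.comp_left (g := fun x => ‖x‖ ^ 2) (by simp)
  have i2 : IntegrableOn (fun z => w z * (2 * ψ.1 z * timeDeriv ψ.1 z + 2 * lam * ψ.1 z ^ 2))
      S.Q := by
    refine (Continuous.integrable_of_hasCompactSupport (by fun_prop) ?_).integrableOn
    refine ψ.2.2.1.mono' ?_
    intro z hz
    by_contra h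
    exact hz (by simp [image_eq_zero_of_notMem_tsupport h])
  have i3 : IntegrableOn (fun z => w z * (-(ψ.1 z * timeDeriv ψ.1 z)
        + S.a z * ‖spatialGrad ψ.1 z‖ ^ 2 + S.b z * ψ.1 z ^ 2)) S.Q := by
    have j1 : Integrable (fun z => w z * (ψ.1 z * timeDeriv ψ.1 z)) (volume.restrict S.Q) := by
      refine (Continuous.integrable_of_hasCompactSupport (by fun_prop) ?_).integrableOn
      exact HasCompactSupport.mul_left ψ.2.2.1.mul_right
    have j2 : Integrable (fun z => S.a z * (w z * ‖spatialGrad ψ.1 z‖ ^ 2))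
        (volume.restrict S.Q) := by
      refine Integrable.essSup_smul ?_ S.a_memLp.1 S.a_memLp.2.ne
      refine (Continuous.integrable_of_hasCompactSupport (by fun_prop) ?_).integrableOn
      exact HasCompactSupport.mul_left (hgc.comp_left (g := fun x => ‖x‖ ^ 2) (by simp))
    have j3 : Integrable (fun z => S.b z * (w z * ψ.1 z ^ 2)) (volume.restrict S.Q) := by
      refine Integrable.essSup_smul ?_ S.b_memLp.1 S.b_memLp.2.ne
      refine (Continuous.integrable_of_hasCompactSupport (by fun_prop) ?_).integrableOn
      exact HasCompactSupport.mul_left (ψ.2.2.1.comp_left (g := fun x => x ^ 2) (by simp))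
    refine ((j2.add j3).sub j1).congr (Eventually.of_forall fun z => ?_)
    simp only [Pi.sub_apply, Pi.add_apply]
    ring
  have hlow : (1 / 2) * (∫ x in S.Ω, ψ.1 (x, 0) ^ 2)
      + c * ∫ z in S.Q, w z * (ψ.1 z ^ 2 + ‖spatialGrad ψ.1 z‖ ^ 2)
      ≤ ⟪S.embL (S.expMul lam ψ), S.adjL ψ⟫_ℝ := by
    have hid := S.integral_time_identity lam ψ
    have : (1 / 2) * (∫ x in S.Ω, ψ.1 (x, 0) ^ 2) = -(1 / 2) * ∫ z in S.Q,
        w z * (2 * ψ.1 z * timeDeriv ψ.1 z + 2 * lam * ψ.1 z ^ 2) := by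
      rw [hid]; ring
    rw [hinner, this, ← integral_const_mul, ← integral_const_mul, ← integral_add (i2.const_mul _) (i1.const_mul _)]
    refine integral_mono_ae ((i2.const_mul _).add (i1.const_mul _)) i3 ?_
    filter_upwards [ha, hb] with z haz hbz
    have hwz : 0 < w z := Real.exp_pos _
    have k1 : 0 ≤ (S.a z - c) * ‖spatialGrad ψ.1 z‖ ^ 2 :=
      mul_nonneg (sub_nonneg.2 ((min_le_right _ _).trans haz)) (sq_nonneg _)
    have k2 : 0 ≤ (S.b z + lam - c) * ψ.1 z ^ 2 := by
      refine mul_nonneg ?_ (sq_nonneg _)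
      have := neg_abs_le (S.b z)
      have : c ≤ 1 := min_le_left _ _
      linarith
    have k3 := mul_nonneg hwz.le (add_nonneg k1 k2)
    linarith
  have hnn : 0 ≤ ∫ x in S.Ω, ψ.1 (x, 0) ^ 2 := integral_nonneg fun x => sq_nonneg _
  have hnn2 : 0 ≤ ∫ z in S.Q, w z * (ψ.1 z ^ 2 + ‖spatialGrad ψ.1 z‖ ^ 2) :=
    integral_nonneg fun z => by positivity
  have hup1 : ‖S.embL (S.expMul lam ψ)‖ ^ 2 ≤
      M * ∫ z in S.Q, w z * (ψ.1 z ^ 2 + ‖spatialGrad ψ.1 z‖ ^ 2) := by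
    rw [norm_embL_sq, ← integral_const_mul]
    refine integral_mono_of_nonneg (Eventually.of_forall fun z => by positivity)
      (i1.const_mul _) ?_
    filter_upwards [ae_restrict_mem S.measurableSet_Q] with z hz
    have hwz : 0 < w z := Real.exp_pos _
    have hwM : w z ≤ M := by
      refine Real.exp_le_exp.2 ?_
      have := hz.2.2.le
      gcongr
    rw [spatialGrad_expMul, norm_smul]
    change (w z * ψ.1 z) ^ 2 + (‖w z‖ * _) ^ 2 ≤ _
    rw [Real.norm_of_nonneg hwz.le]
    calc _ = w z * (w z * (ψ.1 z ^ 2 + ‖spatialGrad ψ.1 z‖ ^ 2)) := by ring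
      _ ≤ _ := by gcongr
  have hup2 : ∫ z in S.Qω, ψ.1 z ^ 2 ≤
      ∫ z in S.Q, w z * (ψ.1 z ^ 2 + ‖spatialGrad ψ.1 z‖ ^ 2) := by
    have i4 : Integrable (fun z => ψ.1 z ^ 2) (volume : Measure (Space d × ℝ)) :=
      (Continuous.integrable_of_hasCompactSupport (by fun_prop)
        (ψ.2.2.1.comp_left (g := fun x => x ^ 2) (by simp)))
    refine (setIntegral_mono_set i4.integrableOn (Eventually.of_forall fun z => sq_nonneg _)
      S.Qω_subset.eventuallyLE).trans ?_
    refine integral_mono_ae i4.integrableOn i1 ?_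
    filter_upwards [ae_restrict_mem S.measurableSet_Q] with z hz
    have hwz : 1 ≤ w z := by
      refine Real.one_le_exp ?_
      have := hz.2.1.le
      positivity
    have : 0 ≤ ‖spatialGrad ψ.1 z‖ ^ 2 := sq_nonneg _
    nlinarith [sq_nonneg (ψ.1 z)]
  constructor
  · calc c / M * ‖S.embL (S.expMul lam ψ)‖ ^ 2
        ≤ c / M * (M * ∫ z in S.Q, w z * (ψ.1 z ^ 2 + ‖spatialGrad ψ.1 z‖ ^ 2)) := by gcongr
      _ = c * ∫ z in S.Q, w z * (ψ.1 z ^ 2 + ‖spatialGrad ψ.1 z‖ ^ 2) := by field_simp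
      _ ≤ _ := by linarith
  · rw [norm_dataL_sq]
    set X := ⟪S.embL (S.expMul lam ψ), S.adjL ψ⟫_ℝ
    set I := ∫ z in S.Q, w z * (ψ.1 z ^ 2 + ‖spatialGrad ψ.1 z‖ ^ 2)
    have hX1 : c * I ≤ X := by linarith
    have hX2 : (∫ x in S.Ω, ψ.1 (x, 0) ^ 2) ≤ 2 * X := by nlinarith
    have hX3 : I ≤ 1 / c * X := by
      rw [one_div, inv_mul_eq_div, le_div_iff₀ hc0]; linarith
    linarith

theorem gradient_slice (φ : S.testFunctions) (t : ℝ) :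
    gradient (fun x => φ.1 (x, t)) = fun x => spatialGrad φ.1 (x, t) := rfl

theorem ae_hasH10Gradient (Y : WithLp 2 (S.L2Q × Lp (Space d) 2 (volume.restrict S.Q)))
    (hY : Y ∈ closure (range S.embL)) :
    ∀ᵐ t ∂(volume.restrict (Ioo 0 S.T)),
      HasH10Gradient S.Ω (fun x => Y.fst (x, t)) (fun x => Y.snd (x, t)) := by
  have h1 : ∀ n : ℕ, ∃ φ : S.testFunctions, ‖S.embL φ - Y‖ₑ < (2⁻¹ : ℝ≥0∞) ^ n := by
    intro n
    have hpos : (0 : ℝ≥0∞) < (2⁻¹ : ℝ≥0∞) ^ n :=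
      pos_iff_ne_zero.2 (pow_ne_zero _ (by simp))
    obtain ⟨_, ⟨φ, rfl⟩, h⟩ := EMetric.mem_closure_iff.1 hY _ hpos
    refine ⟨φ, ?_⟩
    rwa [edist_comm, edist_eq_enorm_sub] at h
  choose φ hφ using h1
  have hu : Measurable (Y.fst : Space d × ℝ → ℝ) := (Lp.stronglyMeasurable Y.fst).measurable
  have hg : Measurable (Y.snd : Space d × ℝ → Space d) := (Lp.stronglyMeasurable Y.snd).measurable
  have m1 : ∀ n, Measurable fun z => (φ n).1 z := fun n => (φ n).2.1.continuous.measurable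
  have m2 : ∀ n, Measurable fun z => spatialGrad (φ n).1 z :=
    fun n => (continuous_spatialGrad (φ n).2.1).measurable
  have sq : ∀ {α : Type} {F : Type} [MeasurableSpace α] [NormedAddCommGroup F] (ν : Measure α)
      (f : α → F), eLpNorm f 2 ν ^ 2 = ∫⁻ x, ‖f x‖ₑ ^ 2 ∂ν := by
    intro α F _ _ ν f
    rw [eLpNorm_eq_lintegral_rpow_enorm_toReal (by simp) (by simp), ← ENNReal.rpow_natCast,
      ← ENNReal.rpow_mul]
    simp
  have fub : ∀ f : Space d × ℝ → ℝ≥0∞, Measurable f →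
      ∫⁻ z in S.Q, f z = ∫⁻ t in Ioo 0 S.T, ∫⁻ x in S.Ω, f (x, t) := by
    intro f hf
    rw [volume_Q, lintegral_prod_symm' _ hf]
  -- finiteness of almost every slice
  have fin1 : ∀ᵐ t ∂(volume.restrict (Ioo 0 S.T)), ∫⁻ x in S.Ω, ‖Y.fst (x, t)‖ₑ ^ 2 < ∞ := by
    refine ae_lt_top (Measurable.lintegral_prod_left'
      (f := fun z => ‖Y.fst z‖ₑ ^ 2) (hu.enorm.pow_const 2)) ?_
    rw [← fub (fun z => ‖Y.fst z‖ₑ ^ 2) (hu.enorm.pow_const 2), ← sq]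
    exact ENNReal.pow_ne_top (Lp.eLpNorm_ne_top _)
  have fin2 : ∀ᵐ t ∂(volume.restrict (Ioo 0 S.T)), ∫⁻ x in S.Ω, ‖Y.snd (x, t)‖ₑ ^ 2 < ∞ := by
    refine ae_lt_top (Measurable.lintegral_prod_left'
      (f := fun z => ‖Y.snd z‖ₑ ^ 2) (hg.enorm.pow_const 2)) ?_
    rw [← fub (fun z => ‖Y.snd z‖ₑ ^ 2) (hg.enorm.pow_const 2), ← sq]
    exact ENNReal.pow_ne_top (Lp.eLpNorm_ne_top _)
  -- summability of almost every slice
  have bound : ∀ {F : Type} [NormedAddCommGroup F] [MeasurableSpace F] [BorelSpace F]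
      [SecondCountableTopology F] (f : ℕ → Space d × ℝ → F), (∀ n, Measurable (f n)) →
      (∀ n, eLpNorm (f n) 2 (volume.restrict S.Q) ≤ (2⁻¹ : ℝ≥0∞) ^ n) →
      ∀ᵐ t ∂(volume.restrict (Ioo 0 S.T)),
        Tendsto (fun n => eLpNorm (fun x => f n (x, t)) 2 (volume.restrict S.Ω)) atTop (𝓝 0) := by
    intro F _ _ _ _ f hf hle
    have hfin : ∫⁻ t in Ioo 0 S.T, ∑' n, ∫⁻ x in S.Ω, ‖f n (x, t)‖ₑ ^ 2 ≠ ∞ := by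
      rw [lintegral_tsum fun n =>
        (Measurable.lintegral_prod_left' (f := fun z => ‖f n z‖ₑ ^ 2)
          ((hf n).enorm.pow_const 2)).aemeasurable]
      have : ∀ n, ∫⁻ t in Ioo 0 S.T, ∫⁻ x in S.Ω, ‖f n (x, t)‖ₑ ^ 2 ≤ (2⁻¹ : ℝ≥0∞) ^ n := by
        intro n
        rw [← fub (fun z => ‖f n z‖ₑ ^ 2) ((hf n).enorm.pow_const 2), ← sq]
        calc _ ≤ ((2⁻¹ : ℝ≥0∞) ^ n) ^ 2 := by gcongr; exact hle n
          _ ≤ (2⁻¹ : ℝ≥0∞) ^ n := by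
            refine pow_le_of_le_one zero_le ?_ two_ne_zero
            exact pow_le_one' (by simp) n
      refine ne_top_of_le_ne_top ?_ (ENNReal.tsum_le_tsum this)
      rw [ENNReal.tsum_geometric]
      simp
    have hm : Measurable fun t => ∑' n, ∫⁻ x in S.Ω, ‖f n (x, t)‖ₑ ^ 2 :=
      Measurable.tsum fun n => Measurable.lintegral_prod_left'
        (f := fun z => ‖f n z‖ₑ ^ 2) ((hf n).enorm.pow_const 2)
    filter_upwards [ae_lt_top hm hfin] with t ht
    have h0 := ENNReal.tendsto_atTop_zero_of_tsum_ne_top ht.ne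
    have h2 := (ENNReal.continuous_rpow_const (y := (1 / 2 : ℝ))).tendsto 0 |>.comp h0
    rw [ENNReal.zero_rpow_of_pos (by norm_num)] at h2
    refine h2.congr fun n => ?_
    simp only [Function.comp]
    rw [← sq, ← ENNReal.rpow_natCast, ← ENNReal.rpow_mul]
    norm_num
  have nrm : ∀ n, eLpNorm ((φ n).1 - (Y.fst : Space d × ℝ → ℝ)) 2 (volume.restrict S.Q) ≤ (2⁻¹ : ℝ≥0∞) ^ n ∧
      eLpNorm (spatialGrad (φ n).1 - (Y.snd : Space d × ℝ → Space d)) 2 (volume.restrict S.Q) ≤ (2⁻¹ : ℝ≥0∞) ^ n := by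
    intro n
    have hn := (hφ n).le
    constructor
    · have e : eLpNorm ((φ n).1 - (Y.fst : Space d × ℝ → ℝ)) 2 (volume.restrict S.Q) = ‖(S.embL (φ n) - Y).fst‖ₑ := by
        rw [WithLp.sub_fst, Lp.enorm_def]
        refine eLpNorm_congr_ae ?_
        have h1 : (S.embL (φ n)).fst =ᵐ[volume.restrict S.Q] (φ n).1 :=
          coeFn_lpMap (volume.restrict S.Q) S.testFunctions.subtype (S.memLp_val _ 2) (φ n)
        filter_upwards [h1, Lp.coeFn_sub (S.embL (φ n)).fst Y.fst] with z a b
        rw [b, Pi.sub_apply, Pi.sub_apply, a]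
      rw [e]
      refine le_trans ?_ hn
      rw [enorm_le_iff_norm_le]
      exact WithLp.norm_fst_le _ _
    · have e : eLpNorm (spatialGrad (φ n).1 - (Y.snd : Space d × ℝ → Space d)) 2 (volume.restrict S.Q)
          = ‖(S.embL (φ n) - Y).snd‖ₑ := by
        rw [WithLp.sub_snd, Lp.enorm_def]
        refine eLpNorm_congr_ae ?_
        have h1 : (S.embL (φ n)).snd =ᵐ[volume.restrict S.Q] spatialGrad (φ n).1 :=
          coeFn_lpMap (volume.restrict S.Q) S.gradL (S.memLp_grad _ 2) (φ n)
        filter_upwards [h1, Lp.coeFn_sub (S.embL (φ n)).snd Y.snd] with z a b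
        rw [b, Pi.sub_apply, Pi.sub_apply, a]
      rw [e]
      refine le_trans ?_ hn
      rw [enorm_le_iff_norm_le]
      exact WithLp.norm_snd_le _ _
  have b1 := bound (fun n => (φ n).1 - (Y.fst : Space d × ℝ → ℝ)) (fun n => (m1 n).sub hu) fun n => (nrm n).1
  have b2 := bound (fun n => spatialGrad (φ n).1 - (Y.snd : Space d × ℝ → Space d)) (fun n => (m2 n).sub hg)
    fun n => (nrm n).2
  filter_upwards [fin1, fin2, b1, b2] with t f1 f2 c1 c2
  have lt_of : ∀ {a : ℝ≥0∞}, a ^ 2 < ∞ → a < ∞ := by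
    intro a ha
    by_contra h
    simp [not_lt_top_iff.1 h] at ha
  refine ⟨⟨(hu.comp (by fun_prop : Measurable fun x : Space d => (x, t))).aestronglyMeasurable,
      lt_of ((sq _ _).trans_lt f1)⟩,
    ⟨(hg.comp (by fun_prop : Measurable fun x : Space d => (x, t))).aestronglyMeasurable,
      lt_of ((sq _ _).trans_lt f2)⟩,
    fun n x => (φ n).1 (x, t), fun n => ⟨?_, S.hasCompactSupport_slice (φ n) t,
      S.tsupport_slice (φ n) t⟩, c1, c2⟩
  exact (φ n).2.1.comp (by fun_prop)

/-- Existence of weak solutions that depend linearly and continuously on the data. -/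
theorem exists_solutionOperator : ∃ F : WithLp 2 (S.L2Qω × S.L2Ω) →L[ℝ] S.L2Q,
    ∀ (v : S.L2Qω) (η : S.L2Ω), S.IsWeakSolution v η (F (WithLp.toLp 2 (v, η))) := by
  obtain ⟨κ, hκ, C, hC, lam, h⟩ := S.coercivity
  obtain ⟨F, hF1, hF2⟩ := exists_variational_solution S.embL S.adjL S.dataL (S.expMul lam) κ C hκ hC
    (fun ψ => (h ψ).1) (fun ψ => (h ψ).2)
  refine ⟨(WithLp.fstL 2 ℝ _ _).comp F, fun v η => ⟨(F (WithLp.toLp 2 (v, η))).snd,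
    S.ae_hasH10Gradient _ (hF1 _), fun φ hφ => ?_⟩⟩
  rw [← S.inner_dataL v η ⟨φ, hφ⟩, ← hF2, S.inner_adjL]
  rfl

/- ### The operators `M`, `M*`, the state `ȳ`, and the Lagrangians -/

/-- The solution operator `(v, η) ↦ y`, where `y` is the weak solution with right-hand side
`v 1_ω` and initial state `η`. -/
def solutionOperator : WithLp 2 (S.L2Qω × S.L2Ω) →L[ℝ] S.L2Q :=
  Classical.choose S.exists_solutionOperator

theorem solutionOperator_spec (v : S.L2Qω) (η : S.L2Ω) :
    S.IsWeakSolution v η (S.solutionOperator (WithLp.toLp 2 (v, η))) :=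
  Classical.choose_spec S.exists_solutionOperator v η

/-- The operator `M : L²(Q_ω) → L²(Q)`: `M v` is the weak solution with right-hand side `v 1_ω`
and zero initial state. -/
def M : S.L2Qω →L[ℝ] S.L2Q :=
  LinearMap.mkContinuous
    { toFun := fun v => S.solutionOperator (WithLp.toLp 2 (v, 0))
      map_add' := fun u v => by
        rw [← map_add]
        congr 1
        rw [← WithLp.toLp_add, Prod.mk_add_mk, add_zero]
      map_smul' := fun c v => by
        rw [RingHom.id_apply, ← map_smul]
        congr 1
        rw [← WithLp.toLp_smul, Prod.smul_mk, smul_zero] }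
    ‖S.solutionOperator‖ fun v => by
      refine (S.solutionOperator.le_opNorm _).trans ?_
      rw [WithLp.norm_toLp_fst]

theorem isWeakSolution_M (v : S.L2Qω) : S.IsWeakSolution v 0 (S.M v) :=
  S.solutionOperator_spec v 0

/-- The adjoint operator `M* : L²(Q) → L²(Q_ω)`. -/
def Mstar : S.L2Q →L[ℝ] S.L2Qω := ContinuousLinearMap.adjoint S.M

/-- The uncontrolled state `ȳ`: the weak solution with `v = 0` and initial state `y₀`. -/
def ybar : S.L2Q := S.solutionOperator (WithLp.toLp 2 (0, S.y₀))

theorem isWeakSolution_ybar : S.IsWeakSolution 0 S.y₀ S.ybar :=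
  S.solutionOperator_spec 0 S.y₀

/-- A weight: a function that is continuous on `Q` and bounded from below there by a positive
constant. No upper bound is imposed, so the weight may blow up as `t → T⁻`. -/
structure IsWeight (ρ : Space d × ℝ → ℝ) : Prop where
  continuousOn : ContinuousOn ρ S.Q
  bounded_below : ∃ c > 0, ∀ z ∈ S.Q, c ≤ ρ z

/-- The control space `𝒰 = {v ∈ L²(Q_ω) : ρ₀ v ∈ L²(Q_ω)}`. -/
def controlSpace (ρ₀ : Space d × ℝ → ℝ) : Submodule ℝ S.L2Qω where
  carrier := {v | MemLp (fun z => ρ₀ z * v z) 2 (volume.restrict S.Qω)}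
  zero_mem' := by
    refine (memLp_congr_ae (g := fun z => ρ₀ z * (0 : S.L2Qω) z) ?_).1 (MemLp.zero (ε := ℝ))
    filter_upwards [Lp.coeFn_zero ℝ 2 (volume.restrict S.Qω)] with z h
    rw [h, Pi.zero_apply, mul_zero]
  add_mem' := fun {u v} hu hv => by
    refine (memLp_congr_ae (g := fun z => ρ₀ z * (u + v : S.L2Qω) z) ?_).1 (MemLp.add hu hv)
    filter_upwards [Lp.coeFn_add u v] with z h
    rw [h, Pi.add_apply, Pi.add_apply, mul_add]
  smul_mem' := fun c v hv => by
    refine (memLp_congr_ae (g := fun z => ρ₀ z * (c • v : S.L2Qω) z) ?_).1 (MemLp.const_smul hv c)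
    filter_upwards [Lp.coeFn_smul c v] with z h
    rw [h, Pi.smul_apply, Pi.smul_apply, smul_eq_mul, smul_eq_mul]
    ring

/-- The truncated weight `ρ_R = min (R, ρ)`. -/
def truncate (R : ℝ) (ρ : Space d × ℝ → ℝ) (z : Space d × ℝ) : ℝ := min R (ρ z)

/-- The truncated cost
`J_R(y, v) = ½ ∬_Q ρ_R² |y|² dx dt + ½ ∬_{Q_ω} ρ₀² |v|² dx dt` on `L²(Q) × 𝒰`. -/
def cost (ρ ρ₀ : Space d × ℝ → ℝ) (R : ℝ) (y : S.L2Q) (v : S.controlSpace ρ₀) : ℝ :=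
  (1 / 2) * (∫ z in S.Q, truncate R ρ z ^ 2 * y z ^ 2)
    + (1 / 2) * ∫ z in S.Qω, ρ₀ z ^ 2 * (v : S.L2Qω) z ^ 2

/-- The Lagrangian `𝓛_R(y, v, q) = J_R(y, v) - (q, M v + ȳ - y)_{L²(Q)}`; the primal variable is
`p = (y, v) ∈ L²(Q) × 𝒰` and the dual variable is `q ∈ L²(Q)`. -/
def lagrangian (ρ ρ₀ : Space d × ℝ → ℝ) (R : ℝ) (p : S.L2Q × S.controlSpace ρ₀) (q : S.L2Q) : ℝ :=
  S.cost ρ ρ₀ R p.1 p.2 - ⟪q, S.M p.2 + S.ybar - p.1⟫_ℝ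

/-- The Augmented Lagrangian
`𝓛_{R,K}(y, v, q) = 𝓛_R(y, v, q) + (K / 2) ‖M v + ȳ - y‖²_{L²(Q)}`. -/
def augmentedLagrangian (ρ ρ₀ : Space d × ℝ → ℝ) (R K : ℝ) (p : S.L2Q × S.controlSpace ρ₀)
    (q : S.L2Q) : ℝ :=
  S.lagrangian ρ ρ₀ R p q + K / 2 * ‖S.M p.2 + S.ybar - p.1‖ ^ 2

/-- `(y, v, q) ∈ L²(Q) × 𝒰 × L²(Q)` is a saddle point of `F`:
`F(y, v, p) ≤ F(y, v, q) ≤ F(z, w, q)` for all `p ∈ L²(Q)` and `(z, w) ∈ L²(Q) × 𝒰`. -/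
def IsSaddlePoint {ρ₀ : Space d × ℝ → ℝ} (F : S.L2Q × S.controlSpace ρ₀ → S.L2Q → ℝ)
    (y : S.L2Q) (v : S.controlSpace ρ₀) (q : S.L2Q) : Prop :=
  (∀ p : S.L2Q, F (y, v) p ≤ F (y, v) q) ∧
    ∀ (z : S.L2Q) (w : S.controlSpace ρ₀), F (y, v) q ≤ F (z, w) q


end ParabolicProblem
end NullControl
end

open MeasureTheory Set Filter Topology
open scoped ENNReal InnerProductSpace

namespace NullControl

/-! ### Quadratic Lagrangians with an affine constraint on inner product spaces. -/

section abstractLagrangian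

variable {H H' G U : Type*} [NormedAddCommGroup H] [InnerProductSpace ℝ H]
  [NormedAddCommGroup H'] [InnerProductSpace ℝ H'] [NormedAddCommGroup G] [InnerProductSpace ℝ G]
  [AddCommGroup U] [Module ℝ U]

/-! Both Lagrangians are affine in the multiplier `q` and convex quadratic in `(y, v)`. Maximality
in `q` forces the constraint `M v + ȳ = y`. At such a point the penalty `K/2 ‖M v + ȳ - y‖²`
vanishes together with its first variation, so the stationarity conditions in `(y, v)` do not
contain `K`; by convexity they are also sufficient for minimality. For every `K ≥ 0` the saddle
points are therefore the solutions of one optimality system: `M v + ȳ = y`, `ρ_R² y + q = 0`, and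
`(ρ₀ v, ρ₀ w) = (q, M w)` for all `w ∈ 𝒰`. The value `K = 0` is the original Lagrangian. This is
`isSaddlePoint_quadraticLagrangian_iff`, which rests on the exact expansion
`quadraticLagrangian_add`.

Uniqueness (`OptimalitySystem.unique`) is an energy identity for the difference of two solutions; it
uses only that multiplication by `ρ_R` and by `ρ₀` is injective.

Existence (`ParabolicProblem.exists_optimalitySystem`) goes through the dual problem. Eliminating `y
= -ρ_R⁻² q` and `v = ρ₀⁻² M* q` leaves `M ρ₀⁻² M* q + ρ_R⁻² q = -ȳ`. Its bilinear form is bounded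
because the weights are bounded below, and coercive because `ρ_R ≤ R`, so Lax-Milgram applies. The
formulas for `y_R` and `v_R` come with the construction. No norm on `𝒰` is needed, and the parabolic
equation enters only through the bounded operator `M` and the element `ȳ`. -/

theorem eq_zero_of_forall_linear_add_sq_nonneg {a b : ℝ} (h : ∀ s : ℝ, 0 ≤ s * a + s ^ 2 * b) :
    a = 0 := by
  have hp : 0 < |b| + 1 := by positivity
  -- The denominator `|b| + 1` is positive whatever the sign of `b`, and it exceeds `b` by at least
  -- one; the expression is then at most `-a² / (|b| + 1)²`.
  have h1 := h (-a / (|b| + 1))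
  have h2 : -a / (|b| + 1) * a + (-a / (|b| + 1)) ^ 2 * b
      = (a ^ 2 * (b - (|b| + 1))) / (|b| + 1) ^ 2 := by field_simp; ring
  rw [h2, div_nonneg_iff] at h1
  have h3 : 0 < (|b| + 1) ^ 2 := by positivity
  have h4 : 0 ≤ a ^ 2 * (b - (|b| + 1)) := by
    rcases h1 with h | h
    · exact h.1
    · exact absurd h.2 (not_le.2 h3)
  have h5 := le_abs_self b
  have h6 : a ^ 2 = 0 := by nlinarith [sq_nonneg a]
  exact pow_eq_zero_iff two_ne_zero |>.1 h6

/-- The augmented Lagrangian of minimizing `½ ‖A y‖² + ½ ‖N v‖²` subject to `y = T v + f`. -/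
noncomputable def quadraticLagrangian (A : H →ₗ[ℝ] H') (N : U →ₗ[ℝ] G) (T : U →ₗ[ℝ] H) (f : H) (K : ℝ)
    (y : H) (v : U) (q : H) : ℝ :=
  1 / 2 * ‖A y‖ ^ 2 + 1 / 2 * ‖N v‖ ^ 2 - ⟪q, T v + f - y⟫_ℝ + K / 2 * ‖T v + f - y‖ ^ 2

variable (A : H →ₗ[ℝ] H') (N : U →ₗ[ℝ] G) (T : U →ₗ[ℝ] H) (f : H)

/-- The optimality system of the minimization of `½ ‖A y‖² + ½ ‖N v‖²` subject to `y = T v + f`. -/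
structure OptimalitySystem (y : H) (v : U) (q : H) : Prop where
  state : T v + f = y
  adjoint : ∀ h, ⟪A y, A h⟫_ℝ + ⟪q, h⟫_ℝ = 0
  control : ∀ w, ⟪N v, N w⟫_ℝ = ⟪q, T w⟫_ℝ

variable {A N T f}

/-- The function is quadratic, so the Taylor expansion is exact at order two. The base point
satisfies the constraint, hence the residual after the shift is `T w - h` alone: `K` appears in the
second-order term and not in the first-order one. -/
theorem quadraticLagrangian_add {K : ℝ} {y : H} {v : U} {q : H} (hs : T v + f = y) (h : H) (w : U) :
    quadraticLagrangian A N T f K (y + h) (v + w) q = quadraticLagrangian A N T f K y v q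
      + ((⟪A y, A h⟫_ℝ + ⟪q, h⟫_ℝ) + (⟪N v, N w⟫_ℝ - ⟪q, T w⟫_ℝ))
      + (1 / 2 * ‖A h‖ ^ 2 + 1 / 2 * ‖N w‖ ^ 2 + K / 2 * ‖T w - h‖ ^ 2) := by
  have e : T (v + w) + f - (y + h) = T w - h := by rw [map_add, ← hs]; abel
  unfold quadraticLagrangian
  rw [e, hs, sub_self, map_add, map_add, norm_add_sq_real, norm_add_sq_real, inner_sub_right]
  simp
  ring

/-- The saddle points of the augmented Lagrangian are the solutions of the optimality system,
whatever the value of the augmentation parameter `K ≥ 0`. -/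
theorem isSaddlePoint_quadraticLagrangian_iff {K : ℝ} (hK : 0 ≤ K) {y : H} {v : U} {q : H} :
    ((∀ p, quadraticLagrangian A N T f K y v p ≤ quadraticLagrangian A N T f K y v q) ∧
      ∀ z w, quadraticLagrangian A N T f K y v q ≤ quadraticLagrangian A N T f K z w q) ↔
    OptimalitySystem A N T f y v q := by
  constructor
  · rintro ⟨h1, h2⟩
    have hs : T v + f = y := by
      -- Moving `q` against the residual raises the Lagrangian by the squared norm of the residual,
      -- which maximality in `q` forbids unless the residual is zero.
      have := h1 (q - (T v + f - y))
      unfold quadraticLagrangian at this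
      rw [inner_sub_left, real_inner_self_eq_norm_sq] at this
      have h0 : ‖T v + f - y‖ ^ 2 = 0 := le_antisymm (by linarith) (sq_nonneg _)
      exact sub_eq_zero.1 (norm_eq_zero.1 (pow_eq_zero_iff two_ne_zero |>.1 h0))
    have key : ∀ h w, (⟪A y, A h⟫_ℝ + ⟪q, h⟫_ℝ) + (⟪N v, N w⟫_ℝ - ⟪q, T w⟫_ℝ) = 0 := by
      intro h w
      -- Minimality along the line `s ↦ (y + s h, v + s w)`: the first-order part scales with `s`,
      -- the remainder `b` with `s²`.
      refine eq_zero_of_forall_linear_add_sq_nonneg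
        (b := 1 / 2 * ‖A h‖ ^ 2 + 1 / 2 * ‖N w‖ ^ 2 + K / 2 * ‖T w - h‖ ^ 2) fun s => ?_
      have := h2 (y + s • h) (v + s • w)
      rw [quadraticLagrangian_add hs] at this
      simp only [map_smul, ← smul_sub, inner_smul_right, norm_smul, mul_pow, Real.norm_eq_abs,
        sq_abs] at this
      linarith
    refine ⟨hs, fun h => ?_, fun w => ?_⟩
    · simpa using key h 0
    · have := key 0 w
      simp only [map_zero, inner_zero_right] at this
      linarith
  · rintro ⟨hs, ha, hc⟩
    refine ⟨fun p => ?_, fun z w => ?_⟩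
    -- With zero residual the value does not depend on the multiplier, so equality holds.
    · simp [quadraticLagrangian, hs]
    · have := quadraticLagrangian_add (A := A) (N := N) (K := K) (q := q) hs (z - y) (w - v)
      rw [ha, hc, add_sub_cancel, add_sub_cancel] at this
      rw [this]
      have : 0 ≤ 1 / 2 * ‖A (z - y)‖ ^ 2 + 1 / 2 * ‖N (w - v)‖ ^ 2
        + K / 2 * ‖T (w - v) - (z - y)‖ ^ 2 := by positivity
      linarith

/-- Differences of solutions solve the homogeneous system. Testing the adjoint equation with `y -
y'` and the control equation with `v - v'`, where `T (v - v') = y - y'`, gives `‖A (y - y')‖² + ‖N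
(v - v')‖² = 0`. The multiplier is then unique because the adjoint equation may be tested with every
`h : H`, in particular with `q - q'`. -/
theorem OptimalitySystem.unique (hA : ∀ y, A y = 0 → y = 0) (hN : ∀ v, N v = 0 → v = 0)
    {y y' : H} {v v' : U} {q q' : H} (h : OptimalitySystem A N T f y v q)
    (h' : OptimalitySystem A N T f y' v' q') : y = y' ∧ v = v' ∧ q = q' := by
  have ha : ∀ p, ⟪A (y - y'), A p⟫_ℝ + ⟪q - q', p⟫_ℝ = 0 := fun p => by
    rw [map_sub, inner_sub_left, inner_sub_left]
    linarith [h.adjoint p, h'.adjoint p]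
  have hc : ∀ w, ⟪N (v - v'), N w⟫_ℝ = ⟪q - q', T w⟫_ℝ := fun w => by
    rw [map_sub, inner_sub_left, inner_sub_left, h.control, h'.control]
  have hs : T (v - v') = y - y' := by
    rw [map_sub, ← h.state, ← h'.state]; abel
  have e1 := ha (y - y')
  have e2 := hc (v - v')
  rw [hs] at e2
  rw [← e2, real_inner_self_eq_norm_sq, real_inner_self_eq_norm_sq] at e1
  have hy : A (y - y') = 0 := norm_eq_zero.1 <| (pow_eq_zero_iff two_ne_zero).1 <|
    le_antisymm (by nlinarith [sq_nonneg ‖N (v - v')‖]) (sq_nonneg _)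
  have hv : N (v - v') = 0 := norm_eq_zero.1 <| (pow_eq_zero_iff two_ne_zero).1 <|
    le_antisymm (by nlinarith [sq_nonneg ‖A (y - y')‖]) (sq_nonneg _)
  refine ⟨sub_eq_zero.1 (hA _ hy), sub_eq_zero.1 (hN _ hv), sub_eq_zero.1 ?_⟩
  have e3 := ha (q - q')
  rw [hy, inner_zero_left, zero_add] at e3
  exact inner_self_eq_zero.1 e3

/-- Lax-Milgram for the sum of two Gram forms, one of which is coercive. -/
theorem exists_inner_add_inner_eq [CompleteSpace H] (P : H →L[ℝ] G) (E : H →L[ℝ] H') {c : ℝ}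
    (hc : 0 < c) (hE : ∀ q, c * ‖q‖ ≤ ‖E q‖) (g : H) :
    ∃ q, ∀ p, ⟪P q, P p⟫_ℝ + ⟪E q, E p⟫_ℝ = ⟪g, p⟫_ℝ := by
  let B : H →L[ℝ] H →L[ℝ] ℝ := (innerSL ℝ).bilinearComp P P + (innerSL ℝ).bilinearComp E E
  -- The term with `P` contributes a nonnegative square, so `E` alone provides the coercivity
  -- constant `c ^ 2`.
  have hB : ∀ q p, B q p = ⟪P q, P p⟫_ℝ + ⟪E q, E p⟫_ℝ := fun q p => rfl
  have hco : IsCoercive B := by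
    refine ⟨c ^ 2, by positivity, fun u => ?_⟩
    rw [hB, real_inner_self_eq_norm_sq, real_inner_self_eq_norm_sq]
    have := pow_le_pow_left₀ (by positivity) (hE u) 2
    nlinarith [sq_nonneg ‖P u‖]
  refine ⟨hco.continuousLinearEquivOfBilin.symm g, fun p => ?_⟩
  rw [← hB, ← hco.continuousLinearEquivOfBilin_apply, ContinuousLinearEquiv.apply_symm_apply]

end abstractLagrangian

/-! ### Multiplication by weights in `L²`. -/

section multiplication

variable {α : Type*} [MeasurableSpace α] {μ : Measure α}

/-- Multiplication of a linear family `J` of elements of `L²` by a weight `w`. -/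
noncomputable def weightL {V : Type*} [AddCommGroup V] [Module ℝ V] (w : α → ℝ) (J : V →ₗ[ℝ] Lp ℝ 2 μ)
    (h : ∀ v, MemLp (fun z => w z * J v z) 2 μ) : V →ₗ[ℝ] Lp ℝ 2 μ where
  toFun v := (h v).toLp _
  map_add' u v := by
    rw [← MemLp.toLp_add]
    refine MemLp.toLp_congr _ _ ?_
    rw [map_add]
    filter_upwards [Lp.coeFn_add (J u) (J v)] with z hz
    rw [hz]
    simp [mul_add]
  map_smul' c v := by
    rw [RingHom.id_apply, ← MemLp.toLp_const_smul]
    refine MemLp.toLp_congr _ _ ?_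
    rw [map_smul]
    filter_upwards [Lp.coeFn_smul c (J v)] with z hz
    rw [hz]
    simp [mul_left_comm]

theorem coeFn_weightL {V : Type*} [AddCommGroup V] [Module ℝ V] (w : α → ℝ) (J : V →ₗ[ℝ] Lp ℝ 2 μ)
    (h : ∀ v, MemLp (fun z => w z * J v z) 2 μ) (v : V) :
    weightL w J h v =ᵐ[μ] fun z => w z * J v z :=
  (h v).coeFn_toLp

/-- Multiplication by a bounded function as an operator on `L²`. -/
noncomputable def boundedMul (w : α → ℝ) (hw : MemLp w ∞ μ) : Lp ℝ 2 μ →L[ℝ] Lp ℝ 2 μ :=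
  (ContinuousLinearMap.mul ℝ ℝ).holderL μ ∞ 2 2 (hw.toLp w)

theorem coeFn_boundedMul (w : α → ℝ) (hw : MemLp w ∞ μ) (u : Lp ℝ 2 μ) :
    boundedMul w hw u =ᵐ[μ] fun z => w z * u z := by
  filter_upwards [(ContinuousLinearMap.mul ℝ ℝ).coeFn_holder (r := 2) (hw.toLp w) u,
    hw.coeFn_toLp] with z h1 h2
  change (ContinuousLinearMap.mul ℝ ℝ).holder 2 (hw.toLp w) u z = _
  rw [h1, h2]
  rfl

theorem inner_Lp_eq (u v : Lp ℝ 2 μ) : ⟪u, v⟫_ℝ = ∫ z, u z * v z ∂μ := by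
  rw [L2.inner_def]
  refine integral_congr_ae (.of_forall fun z => ?_)
  simp [mul_comm]

/-- This turns the weighted integrals of the cost into the squared norms of the abstract Lagrangian.
-/
theorem norm_sq_Lp_eq_of_ae_eq_mul {u x : Lp ℝ 2 μ} {w : α → ℝ} (h : u =ᵐ[μ] fun z => w z * x z) :
    ‖u‖ ^ 2 = ∫ z, w z ^ 2 * x z ^ 2 ∂μ := by
  rw [← real_inner_self_eq_norm_sq, inner_Lp_eq]
  refine integral_congr_ae ?_
  filter_upwards [h] with z hz
  rw [hz]
  ring

theorem norm_le_of_ae_eq_mul {u x : Lp ℝ 2 μ} {w : α → ℝ} {C : ℝ} (h : u =ᵐ[μ] fun z => w z * x z)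
    (hw : ∀ᵐ z ∂μ, ‖w z‖ ≤ C) : ‖u‖ ≤ C * ‖x‖ := by
  refine Lp.norm_le_mul_norm_of_ae_le_mul ?_
  filter_upwards [h, hw] with z h1 h2
  rw [h1, norm_mul]
  gcongr

end multiplication

/-! ### The control problem as an instance of the abstract one, and the dual construction. -/

namespace ParabolicProblem

variable {d : ℕ} {S : ParabolicProblem d} {ρ ρ₀ : Space d × ℝ → ℝ} {R : ℝ}

theorem IsWeight.ae_pos (h : S.IsWeight ρ) : ∀ᵐ z ∂(volume.restrict S.Q), 0 < ρ z := by
  obtain ⟨c, hc, h⟩ := h.bounded_below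
  filter_upwards [ae_restrict_mem S.measurableSet_Q] with z hz using hc.trans_le (h z hz)

theorem IsWeight.truncate (h : S.IsWeight ρ) (hR : 0 < R) : S.IsWeight (truncate R ρ) := by
  obtain ⟨c, hc, hb⟩ := h.bounded_below
  exact ⟨ContinuousOn.inf continuousOn_const h.continuousOn,
    min R c, lt_min hR hc, fun z hz => min_le_min_left R (hb z hz)⟩

/-- A weight may blow up, but its lower bound makes the reciprocal bounded; the existence proof
therefore works with reciprocals. -/
theorem IsWeight.memLp_inv (h : S.IsWeight ρ) :
    MemLp (fun z => (ρ z)⁻¹) ∞ (volume.restrict S.Q) := by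
  obtain ⟨c, hc, hb⟩ := h.bounded_below
  refine memLp_top_of_bound ((h.continuousOn.inv₀ fun z hz =>
    (hc.trans_le (hb z hz)).ne').aestronglyMeasurable S.measurableSet_Q) c⁻¹ ?_
  filter_upwards [ae_restrict_mem S.measurableSet_Q] with z hz
  have := hc.trans_le (hb z hz)
  rw [Real.norm_of_nonneg (by positivity)]
  exact inv_anti₀ hc (hb z hz)

theorem IsWeight.norm_truncate_le (h : S.IsWeight ρ) (hR : 0 < R) :
    ∀ᵐ z ∂(volume.restrict S.Q), ‖ParabolicProblem.truncate R ρ z‖ ≤ R := by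
  filter_upwards [(h.truncate hR).ae_pos] with z hz
  rw [Real.norm_of_nonneg hz.le]
  exact min_le_left _ _

theorem IsWeight.memLp_truncate (h : S.IsWeight ρ) (hR : 0 < R) :
    MemLp (ParabolicProblem.truncate R ρ) ∞ (volume.restrict S.Q) :=
  memLp_top_of_bound ((h.truncate hR).continuousOn.aestronglyMeasurable S.measurableSet_Q) R
    (h.norm_truncate_le hR)

theorem restrict_Qω_le : (volume.restrict S.Qω : Measure (Space d × ℝ)) ≤ volume.restrict S.Q :=
  Measure.restrict_mono_set _ S.Qω_subset

variable (S ρ₀) in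
/-- The operator `v ↦ ρ₀ v` from `𝒰` to `L²(Q_ω)`. -/
noncomputable def controlWeight : S.controlSpace ρ₀ →ₗ[ℝ] S.L2Qω :=
  weightL ρ₀ (S.controlSpace ρ₀).subtype fun v => v.2

theorem coeFn_controlWeight (v : S.controlSpace ρ₀) :
    S.controlWeight ρ₀ v =ᵐ[volume.restrict S.Qω] fun z => ρ₀ z * (v : S.L2Qω) z :=
  coeFn_weightL _ _ _ v

variable (S ρ₀) in
/-- The control-to-state operator on `𝒰`. -/
noncomputable def controlM : S.controlSpace ρ₀ →ₗ[ℝ] S.L2Q := S.M.toLinearMap ∘ₗ (S.controlSpace ρ₀).subtype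

/-- The dictionary is `A = ρ_R ·`, `N = ρ₀ ·` on `𝒰`, `T = M` on `𝒰`, `f = ȳ`. Truncation makes `A`
a bounded operator on `L²(Q)`, whereas `N` is merely linear, since `ρ₀` need not be bounded. -/
theorem augmentedLagrangian_eq (hρ : S.IsWeight ρ) (hR : 0 < R) (K : ℝ) (y : S.L2Q)
    (v : S.controlSpace ρ₀) (q : S.L2Q) :
    S.augmentedLagrangian ρ ρ₀ R K (y, v) q = quadraticLagrangian
      (boundedMul _ (hρ.memLp_truncate hR)).toLinearMap (S.controlWeight ρ₀) (S.controlM ρ₀) S.ybar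
      K y v q := by
  unfold augmentedLagrangian lagrangian cost quadraticLagrangian
  rw [norm_sq_Lp_eq_of_ae_eq_mul (coeFn_controlWeight v)]
  have := norm_sq_Lp_eq_of_ae_eq_mul (coeFn_boundedMul _ (hρ.memLp_truncate hR) y)
  rw [← this]
  rfl

theorem lagrangian_eq_augmentedLagrangian (p : S.L2Q × S.controlSpace ρ₀) (q : S.L2Q) :
    S.lagrangian ρ ρ₀ R p q = S.augmentedLagrangian ρ ρ₀ R 0 p q := by
  simp [augmentedLagrangian]

theorem isSaddlePoint_augmentedLagrangian_iff (hρ : S.IsWeight ρ) (hR : 0 < R) {K : ℝ} (hK : 0 ≤ K)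
    {y : S.L2Q} {v : S.controlSpace ρ₀} {q : S.L2Q} :
    S.IsSaddlePoint (S.augmentedLagrangian ρ ρ₀ R K) y v q ↔ OptimalitySystem
      (boundedMul _ (hρ.memLp_truncate hR)).toLinearMap (S.controlWeight ρ₀) (S.controlM ρ₀) S.ybar
      y v q := by
  rw [← isSaddlePoint_quadraticLagrangian_iff hK]
  simp only [IsSaddlePoint, augmentedLagrangian_eq hρ hR]

theorem isSaddlePoint_lagrangian_iff (hρ : S.IsWeight ρ) (hR : 0 < R) {y : S.L2Q}
    {v : S.controlSpace ρ₀} {q : S.L2Q} :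
    S.IsSaddlePoint (S.lagrangian ρ ρ₀ R) y v q ↔ OptimalitySystem
      (boundedMul _ (hρ.memLp_truncate hR)).toLinearMap (S.controlWeight ρ₀) (S.controlM ρ₀) S.ybar
      y v q := by
  rw [← isSaddlePoint_augmentedLagrangian_iff hρ hR le_rfl]
  simp only [IsSaddlePoint, lagrangian_eq_augmentedLagrangian]

theorem eq_zero_of_boundedMul_truncate_eq_zero (hρ : S.IsWeight ρ) (hR : 0 < R) (y : S.L2Q)
    (h : boundedMul _ (hρ.memLp_truncate hR) y = 0) : y = 0 := by
  rw [Lp.eq_zero_iff_ae_eq_zero] at h ⊢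
  filter_upwards [h, coeFn_boundedMul _ (hρ.memLp_truncate hR) y, (hρ.truncate hR).ae_pos]
    with z h1 h2 h3
  rw [h1] at h2
  exact (mul_eq_zero.1 h2.symm).resolve_left h3.ne'

theorem eq_zero_of_controlWeight_eq_zero (hρ₀ : S.IsWeight ρ₀) (v : S.controlSpace ρ₀)
    (h : S.controlWeight ρ₀ v = 0) : v = 0 := by
  rw [← Submodule.coe_eq_zero]
  rw [Lp.eq_zero_iff_ae_eq_zero] at h ⊢
  filter_upwards [h, coeFn_controlWeight v, ae_mono restrict_Qω_le hρ₀.ae_pos] with z h1 h2 h3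
  rw [h1] at h2
  exact (mul_eq_zero.1 h2.symm).resolve_left h3.ne'

/-- The multiplier is found first, from `M ρ₀⁻² M* q + ρ_R⁻² q = -ȳ` in weak form; `y` and `v` are
then defined by the required formulas. The state equation is this dual equation read backwards, and
the other two equations hold by cancellation of weights. -/
theorem exists_optimalitySystem (hρ : S.IsWeight ρ) (hρ₀ : S.IsWeight ρ₀) (hR : 0 < R) :
    ∃ (y : S.L2Q) (v : S.controlSpace ρ₀) (q : S.L2Q),
      OptimalitySystem (boundedMul _ (hρ.memLp_truncate hR)).toLinearMap (S.controlWeight ρ₀)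
        (S.controlM ρ₀) S.ybar y v q ∧
      (∀ᵐ z ∂(volume.restrict S.Q), y z = -((ParabolicProblem.truncate R ρ z ^ 2)⁻¹ * q z)) ∧
      ∀ᵐ z ∂(volume.restrict S.Qω), (v : S.L2Qω) z = (ρ₀ z ^ 2)⁻¹ * S.Mstar q z := by
  let D := boundedMul _ (hρ₀.memLp_inv.mono_measure restrict_Qω_le)
  let E := boundedMul _ (hρ.truncate hR).memLp_inv
  have hD : ∀ u, D u =ᵐ[volume.restrict S.Qω] fun z => (ρ₀ z)⁻¹ * u z := coeFn_boundedMul _ _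
  have hE : ∀ u, E u =ᵐ[volume.restrict S.Q]
    fun z => (ParabolicProblem.truncate R ρ z)⁻¹ * u z := coeFn_boundedMul _ _
  have pos := (hρ.truncate hR).ae_pos
  have pos₀ := ae_mono restrict_Qω_le hρ₀.ae_pos
  -- Coercivity comes from the truncation: `q = ρ_R (ρ_R⁻¹ q)` and `ρ_R ≤ R` give `R⁻¹ ‖q‖ ≤ ‖ρ_R⁻¹
  -- q‖`.
  obtain ⟨q, hq⟩ := exists_inner_add_inner_eq (D.comp S.Mstar) E (inv_pos.2 hR) (fun q => by
    rw [inv_mul_le_iff₀ hR]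
    refine norm_le_of_ae_eq_mul (w := ParabolicProblem.truncate R ρ) ?_ (hρ.norm_truncate_le hR)
    filter_upwards [hE q, pos] with z h1 h2
    rw [h1, mul_inv_cancel_left₀ h2.ne']) (-S.ybar)
  -- For `v = ρ₀⁻² M* q` the product `ρ₀ v = ρ₀⁻¹ M* q` is again in `L²(Q_ω)`. This is what puts `v`
  -- in `𝒰`.
  have hv : (fun z => ρ₀ z * D (D (S.Mstar q)) z) =ᵐ[volume.restrict S.Qω] D (S.Mstar q) := by
    filter_upwards [hD (D (S.Mstar q)), pos₀] with z h1 h2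
    rw [h1, mul_inv_cancel_left₀ h2.ne']
  let v : S.controlSpace ρ₀ := ⟨D (D (S.Mstar q)), (memLp_congr_ae hv).2 (Lp.memLp _)⟩
  have hN : S.controlWeight ρ₀ v = D (S.Mstar q) :=
    Lp.ext ((coeFn_controlWeight v).trans hv)
  refine ⟨-E (E q), v, q, ⟨?_, fun h => ?_, fun w => ?_⟩, ?_, ?_⟩
  -- State equation, tested with `p`: transposing `M` and moving one reciprocal weight to the other
  -- factor recovers the two forms in `hq`.
  · refine ext_inner_right ℝ fun p => ?_
    have h1 := hq p
    have h2 : ⟪S.controlM ρ₀ v, p⟫_ℝ = ⟪D (S.Mstar q), D (S.Mstar p)⟫_ℝ := by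
      change ⟪S.M (D (D (S.Mstar q))), p⟫_ℝ = _
      rw [← ContinuousLinearMap.adjoint_inner_right]
      change ⟪_, S.Mstar p⟫_ℝ = _
      rw [inner_Lp_eq, inner_Lp_eq]
      refine integral_congr_ae ?_
      filter_upwards [hD (D (S.Mstar q)), hD (S.Mstar p)] with z h1 h2
      rw [h1, h2]
      ring
    have h3 : ⟪E (E q), p⟫_ℝ = ⟪E q, E p⟫_ℝ := by
      rw [inner_Lp_eq, inner_Lp_eq]
      refine integral_congr_ae ?_
      filter_upwards [hE (E q), hE p] with z h1 h2
      rw [h1, h2]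
      ring
    rw [inner_neg_left] at h1 ⊢
    rw [inner_add_left, h2, h3]
    change ⟪D (S.Mstar q), D (S.Mstar p)⟫_ℝ + _ = _ at h1
    linarith
  -- Adjoint equation: pointwise, `(ρ_R · ρ_R⁻² q)(ρ_R h) = q h`.
  · rw [map_neg, inner_neg_left, neg_add_eq_zero, inner_Lp_eq, inner_Lp_eq]
    refine integral_congr_ae ?_
    filter_upwards [coeFn_boundedMul _ (hρ.memLp_truncate hR) (E (E q)),
      coeFn_boundedMul _ (hρ.memLp_truncate hR) h, hE (E q), hE q, pos] with z h1 h2 h3 h4 h5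
    change boundedMul _ (hρ.memLp_truncate hR) (E (E q)) z *
      boundedMul _ (hρ.memLp_truncate hR) h z = _
    rw [h1, h2, h3, h4]
    field_simp
  -- Control equation: pointwise, `(ρ₀⁻¹ M* q)(ρ₀ w) = (M* q) w`, whose integral is `(q, M w)`.
  · rw [hN]
    change _ = ⟪q, S.M w⟫_ℝ
    rw [← ContinuousLinearMap.adjoint_inner_left]
    change _ = ⟪S.Mstar q, _⟫_ℝ
    rw [inner_Lp_eq, inner_Lp_eq]
    refine integral_congr_ae ?_
    filter_upwards [hD (S.Mstar q), coeFn_controlWeight w, pos₀] with z h1 h2 h3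
    rw [h1, h2]
    field_simp
  · filter_upwards [Lp.coeFn_neg (E (E q)), hE (E q), hE q] with z h1 h2 h3
    rw [h1, Pi.neg_apply, h2, h3, ← mul_assoc, ← mul_inv, sq]
  · filter_upwards [hD (D (S.Mstar q)), hD (S.Mstar q)] with z h1 h2
    change D (D (S.Mstar q)) z = _
    rw [h1, h2, ← mul_assoc, ← mul_inv, sq]

end ParabolicProblem

end NullControl

theorem theorem3p2 {d : ℕ} (S : NullControl.ParabolicProblem d)
    (ρ ρ₀ : NullControl.Space d × ℝ → ℝ) (hρ : S.IsWeight ρ) (hρ₀ : S.IsWeight ρ₀)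
    (R K : ℝ) (hR : 0 < R) (hK : 0 < K) :
    -- the two Lagrangians have the same saddle points
    (∀ (y : S.L2Q) (v : S.controlSpace ρ₀) (q : S.L2Q),
      S.IsSaddlePoint (S.lagrangian ρ ρ₀ R) y v q ↔
        S.IsSaddlePoint (S.augmentedLagrangian ρ ρ₀ R K) y v q) ∧
    -- the Augmented Lagrangian has exactly one saddle point
    ∃ (yR : S.L2Q) (vR : S.controlSpace ρ₀) (qR : S.L2Q),
      S.IsSaddlePoint (S.augmentedLagrangian ρ ρ₀ R K) yR vR qR ∧
      (∀ (y : S.L2Q) (v : S.controlSpace ρ₀) (q : S.L2Q),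
        S.IsSaddlePoint (S.augmentedLagrangian ρ ρ₀ R K) y v q → y = yR ∧ v = vR ∧ q = qR) ∧
      -- `y_R = -ρ_R⁻² q_R` in `Q` and `v_R = ρ₀⁻² M* q_R` in `Q_ω`
      (∀ᵐ z ∂(MeasureTheory.volume.restrict S.Q),
        yR z = -((NullControl.ParabolicProblem.truncate R ρ z ^ 2)⁻¹ * qR z)) ∧
      (∀ᵐ z ∂(MeasureTheory.volume.restrict S.Qω),
        (vR : S.L2Qω) z = (ρ₀ z ^ 2)⁻¹ * S.Mstar qR z) ∧
      -- the two Lagrangians take the same value there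
      S.augmentedLagrangian ρ ρ₀ R K (yR, vR) qR = S.lagrangian ρ ρ₀ R (yR, vR) qR := by
  refine ⟨fun y v q => ?_, ?_⟩
  · rw [NullControl.ParabolicProblem.isSaddlePoint_lagrangian_iff hρ hR,
      NullControl.ParabolicProblem.isSaddlePoint_augmentedLagrangian_iff hρ hR hK.le]
  · obtain ⟨y, v, q, h, hy, hv⟩ :=
      NullControl.ParabolicProblem.exists_optimalitySystem hρ hρ₀ hR
    refine ⟨y, v, q,
      (NullControl.ParabolicProblem.isSaddlePoint_augmentedLagrangian_iff hρ hR hK.le).2 h,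
      fun y' v' q' h' => ?_, hy, hv, ?_⟩
    · rw [NullControl.ParabolicProblem.isSaddlePoint_augmentedLagrangian_iff hρ hR hK.le] at h'
      exact h'.unique
        (NullControl.ParabolicProblem.eq_zero_of_boundedMul_truncate_eq_zero hρ hR)
        (NullControl.ParabolicProblem.eq_zero_of_controlWeight_eq_zero hρ₀) h
    -- The saddle point satisfies the constraint, so the penalty term vanishes there.
    · have hs : S.M v + S.ybar - y = 0 := sub_eq_zero.2 h.state
      simp [NullControl.ParabolicProblem.augmentedLagrangian, hs]
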